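/- **Setting.** Let $J,I\subseteq\mathbb R$ be open intervals. On $2\times2$ real matrices let $\langle\cdot,\cdot\rangle$ be the inner product obtained by polarizing $q(X)=-\det X$; the group $\mathrm{SL}(2,\mathbb R)$ with the induced Lorentzian metric is the anti-de Sitter space $\mathrm{AdS}$. A *null curve* $\gamma:J\to\mathrm{AdS}$ is a smooth immersed curve with $\langle\gamma',\gamma'\rangle=0$ that is future-directed (the bivector $\gamma\wedge\gamma'$, which is of type $(-,0)$, has positive inner product with $\begin{pmatrix}1&0\\0&1\end{pmatrix}\wedge\begin{pmatrix}0&1\\-1&0\end{pmatrix}$), has no inflection points ($\gamma'\wedge\gamma''\neq0$) and is parameterized by the proper time ($\langle\gamma'',\gamma''\rangle=4$). Its *bending* is $\kappa=-\frac1{16}\langle\gamma''',\gamma'''\rangle$. A *spinor frame field* along $\gamma$ is a pair $F_\pm:J\to\mathrm{SL}(2,\mathbb R)$ with $$\gamma=F_+F_-^{-1},\qquad F_\pm'=F_\pm\begin{pmatrix}0&\kappa\pm1\\1&0\end{pmatrix};$$ the first columns $\eta_\pm$ of $F_\pm$ are the *cousins* of $\gamma$. They are star-shaped plane curves with $\det(\eta_\pm,\eta_\pm')=1$.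 Two null curves $\gamma,\widetilde\gamma$ are *$\mathcal T$-transforms of each other (for $\chi=0$)* if, for the cousins $\eta_\pm$ of $\gamma$ and $\widetilde\eta_\pm$ of $\widetilde\gamma$, both $\det(\eta_+,\widetilde\eta_+)$ and $\det(\eta_-,\widetilde\eta_-)$ are nonzero constants and $$\det(\eta_+,\widetilde\eta_+)\det(\eta_-,\widetilde\eta_-')-\det(\eta_-,\widetilde\eta_-)\det(\eta_+,\widetilde\eta_+')=0 .$$ For a constant $\xi\ne0$, a null curve $\widetilde\gamma$ is *the $\mathcal T$-transform of $\gamma$ with parameter $\xi$ and transforming function $f:J\to\mathbb R$* if $f'+f^2=\kappa+\cosh(2\xi)$ and $$\widetilde\gamma=\pm F_+\begin{pmatrix}\tanh\xi&-\operatorname{csch}\xi\,\operatorname{sech}\xi\,f\\0&\coth\xi\end{pmatrix}F_-^{-1}$$ for a spinor frame field $(F_+,F_-)$ along $\gamma$. A smooth map $\gamma:J\times I\to\mathrm{AdS}$, $\gamma(s,t)=\gamma_t(s)$, such that every $\gamma_t$ is a null curve, with bending $\kappa(s,t)$, *solves the LIEN flow* if $\partial_t\gamma=2\partial_s^3\gamma-6\kappa\,\partial_s\gamma$.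 The KdV equation is $\partial_t\kappa+\partial_s^3\kappa-6\kappa\,\partial_s\kappa=0$. The *Bäcklund transform* of a solution $\kappa$ of the KdV equation with spectral parameter $\lambda\neq0$ and transforming function $f$ is $-\kappa+2f^2-2\lambda$. The *Wahlquist–Estabrook equation* is $$df=(\kappa-f^2+\lambda)\,ds+\bigl(4\lambda(f^2-\lambda)-2\kappa(f^2+\lambda)+2\kappa^2+2f\,\partial_s\kappa-\partial_s^2\kappa\bigr)\,dt .$$ **Theorem.** Let $\gamma:J\times I\to\mathrm{AdS}$ be a solution of the LIEN flow with bending $\kappa(s,t)$, and let $(F_+,F_-)$ be a spinor frame field along $\gamma_t$ for every $t\in I$. Let $\xi\neq0$ be a constant and let $f:J\times I\to\mathbb R$ be a solution of the Wahlquist–Estabrook equation for $\lambda=\cosh(2\xi)$. Define, with one fixed choice of the sign, $$\widetilde\gamma=\pm F_+\begin{pmatrix}\tanh\xi&-\operatorname{csch}\xi\,\operatorname{sech}\xi\,f\\0&\coth\xi\end{pmatrix}F_-^{-1}:J\times I\to\mathrm{AdS}.$$ Then: 1. For every $t\in I$, $\widetilde\gamma_t$ is a null curve, $\gamma_t$ and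 $\widetilde\gamma_t$ are $\mathcal T$-transforms of each other for $\chi=0$, and $\widetilde\gamma_t$ is the $\mathcal T$-transform of $\gamma_t$ with parameter $\xi$ and transforming function $f_t=f(\cdot,t)$. 2. $\widetilde\gamma$ is a solution of the LIEN flow, $\kappa$ solves the KdV equation, and the bending of $\widetilde\gamma$ is the Bäcklund transform $\widetilde\kappa=-\kappa+2f^2-2\lambda$ of $\kappa$ with spectral parameter $\lambda=\cosh(2\xi)$ and transforming function $f$. -/

import Mathlib

open scoped ContDiff MatrixGroups Matrix.Norms.Elementwise

noncomputable section

namespace NullCurveKdV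

/-- The vector space of `2 × 2` real matrices. -/
abbrev Mat2 : Type := Matrix (Fin 2) (Fin 2) ℝ

/-- The inner product of signature `(-,-,+,+)` on `2 × 2` real matrices obtained by polarizing the
quadratic form `q(X) = -det X`. The group `SL(2, ℝ)` with the induced Lorentzian metric is the
anti-de Sitter 3-space. -/
def adsInner (X Y : Mat2) : ℝ :=
  (X 0 1 * Y 1 0 + X 1 0 * Y 0 1 - X 0 0 * Y 1 1 - X 1 1 * Y 0 0) / 2

theorem adsInner_self (X : Mat2) : adsInner X X = -X.det := by
  rw [Matrix.det_fin_two]; unfold adsInner; ring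

/-- The inner product `⟨⟨U ∧ V, W ∧ Z⟩⟩` of two decomposable bivectors. -/
def bivectorInner (U V W Z : Mat2) : ℝ :=
  adsInner U W * adsInner V Z - adsInner U Z * adsInner V W

/-- The bivector `W ∧ Z` is of type `(-,0)`: it is nonzero and the restriction of the inner product
to the plane spanned by `W, Z` is nonzero, negative semidefinite and degenerate. -/
def IsTypeNegZero (W Z : Mat2) : Prop :=
  LinearIndependent ℝ ![W, Z] ∧
  (∀ X ∈ Submodule.span ℝ {W, Z}, adsInner X X ≤ 0) ∧
  (∃ X ∈ Submodule.span ℝ {W, Z}, adsInner X X ≠ 0) ∧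
  (∃ X ∈ Submodule.span ℝ {W, Z}, X ≠ 0 ∧ ∀ Y ∈ Submodule.span ℝ {W, Z}, adsInner X Y = 0)

/-- `W ∧ Z` is a positive bivector of type `(-,0)`, positivity being measured against the fixed
bivector `1 ∧ [[0, 1], [-1, 0]]` of type `(-,-)`. -/
def IsPositiveBivector (W Z : Mat2) : Prop :=
  IsTypeNegZero W Z ∧ 0 < bivectorInner !![1, 0; 0, 1] !![0, 1; -1, 0] W Z

/-- The `n`-th derivative, in the space of matrices, of a curve in `SL(2, ℝ)`. -/
def curveDeriv (n : ℕ) (γ : ℝ → SL(2, ℝ)) : ℝ → Mat2 :=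
  iteratedDeriv n fun s => (γ s : Mat2)

/-- The bending `κ = -(1/16) ⟨γ''', γ'''⟩` of a curve parameterized by the proper time. -/
def bending (γ : ℝ → SL(2, ℝ)) (s : ℝ) : ℝ :=
  -(1 / 16) * adsInner (curveDeriv 3 γ s) (curveDeriv 3 γ s)

/-- A null curve in anti-de Sitter space on the interval `J`, with the standing assumptions: smooth,
immersed, null, future-directed, without inflection points, parameterized by the proper time. -/
structure IsNullCurve (J : Set ℝ) (γ : ℝ → SL(2, ℝ)) : Prop where
  smooth : ContDiffOn ℝ ∞ (fun s => (γ s : Mat2)) J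
  immersed : ∀ s ∈ J, curveDeriv 1 γ s ≠ 0
  null : ∀ s ∈ J, adsInner (curveDeriv 1 γ s) (curveDeriv 1 γ s) = 0
  future : ∀ s ∈ J, IsPositiveBivector (γ s : Mat2) (curveDeriv 1 γ s)
  no_inflection : ∀ s ∈ J, LinearIndependent ℝ ![curveDeriv 1 γ s, curveDeriv 2 γ s]
  proper_time : ∀ s ∈ J, adsInner (curveDeriv 2 γ s) (curveDeriv 2 γ s) = 4

/-- `(Fp, Fm)` is a spinor frame field along the null curve `γ` on `J`: a lift `γ = Fp Fm⁻¹` that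
satisfies the spinorial Frenet-type equations. -/
structure IsSpinorFrame (J : Set ℝ) (γ Fp Fm : ℝ → SL(2, ℝ)) : Prop where
  lift : ∀ s ∈ J, γ s = Fp s * (Fm s)⁻¹
  frenet_pos : ∀ s ∈ J, HasDerivAt (fun u => (Fp u : Mat2))
    ((Fp s : Mat2) * !![0, bending γ s + 1; 1, 0]) s
  frenet_neg : ∀ s ∈ J, HasDerivAt (fun u => (Fm u : Mat2))
    ((Fm s : Mat2) * !![0, bending γ s - 1; 1, 0]) s

/-- The determinant of two plane vectors, written as the columns of a matrix. -/
def det2 (u v : Fin 2 → ℝ) : ℝ := u 0 * v 1 - u 1 * v 0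

/-- A smooth star-shaped plane curve parameterized by the central affine arc length. The equation
`det (η, η') = 1` forces `η` to avoid the origin. -/
structure IsStarShaped (J : Set ℝ) (η : ℝ → Fin 2 → ℝ) : Prop where
  smooth : ContDiffOn ℝ ∞ η J
  arc_length : ∀ s ∈ J, det2 (η s) (deriv η s) = 1

/-- Two star-shaped curves are `𝒯`-transforms of each other: `det (η, η̃)` is a nonzero constant. -/
def IsStarTTransform (J : Set ℝ) (η η' : ℝ → Fin 2 → ℝ) : Prop :=
  IsStarShaped J η ∧ IsStarShaped J η' ∧ ∃ c : ℝ, c ≠ 0 ∧ ∀ s ∈ J, det2 (η s) (η' s) = c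

/-- The cousin determined by one component of a spinor frame field: its first column. -/
def cousin (F : ℝ → SL(2, ℝ)) (s : ℝ) : Fin 2 → ℝ := fun i => (F s : Mat2) i 0

/-- The null curves `γ` and `γ'` on `J` are `𝒯`-transforms of each other, with the constant `χ`:
the associated cousins are `𝒯`-transforms of each other, and
`det (η₊, η̃₊) det (η₋, η̃₋') - det (η₋, η̃₋) det (η₊, η̃₊') = χ`. -/
def IsTTransform (J : Set ℝ) (χ : ℝ) (γ γ' : ℝ → SL(2, ℝ)) : Prop :=
  IsNullCurve J γ ∧ IsNullCurve J γ' ∧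
  ∃ Fp Fm Gp Gm : ℝ → SL(2, ℝ),
    IsSpinorFrame J γ Fp Fm ∧ IsSpinorFrame J γ' Gp Gm ∧
    IsStarTTransform J (cousin Fp) (cousin Gp) ∧
    IsStarTTransform J (cousin Fm) (cousin Gm) ∧
    ∀ s ∈ J,
      det2 (cousin Fp s) (cousin Gp s) * det2 (cousin Fm s) (deriv (cousin Gm) s) -
        det2 (cousin Fm s) (cousin Gm s) * det2 (cousin Fp s) (deriv (cousin Gp) s) = χ

/-- The matrix `[[tanh ξ, -csch ξ sech ξ y], [0, coth ξ]]`, of determinant one for `ξ ≠ 0`. -/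
def transformMatrix (ξ : ℝ) (hξ : ξ ≠ 0) (y : ℝ) : SL(2, ℝ) :=
  ⟨!![Real.tanh ξ, -((Real.sinh ξ)⁻¹ * (Real.cosh ξ)⁻¹ * y);
      0, Real.cosh ξ / Real.sinh ξ], by
    have h1 : Real.sinh ξ ≠ 0 := by simpa using hξ
    have h2 : Real.cosh ξ ≠ 0 := (Real.cosh_pos ξ).ne'
    rw [Matrix.det_fin_two_of, Real.tanh_eq_sinh_div_cosh]
    field_simp
    ring⟩

/-- `γ'` is the `𝒯`-transform (for `χ = 0`) of the null curve `γ` with parameter `ξ` and transforming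
function `f`: the function `f` solves the Riccati equation `f' + f² = κ + cosh (2ξ)` and
`γ' = ± F₊ [[tanh ξ, -csch ξ sech ξ f], [0, coth ξ]] F₋⁻¹`. -/
def IsTTransformWith (J : Set ℝ) (ξ : ℝ) (hξ : ξ ≠ 0) (f : ℝ → ℝ)
    (γ γ' : ℝ → SL(2, ℝ)) : Prop :=
  IsNullCurve J γ ∧ IsNullCurve J γ' ∧
  (∀ s ∈ J, HasDerivAt f (bending γ s + Real.cosh (2 * ξ) - f s ^ 2) s) ∧
  ∃ Fp Fm : ℝ → SL(2, ℝ), IsSpinorFrame J γ Fp Fm ∧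
    ((∀ s ∈ J, γ' s = Fp s * transformMatrix ξ hξ (f s) * (Fm s)⁻¹) ∨
     (∀ s ∈ J, γ' s = -(Fp s * transformMatrix ξ hξ (f s) * (Fm s)⁻¹)))

/-- The bending `κ(s, t)` of a one-parameter family of curves `γ_t(s) = γ s t`. -/
def familyBending (γ : ℝ → ℝ → SL(2, ℝ)) (s t : ℝ) : ℝ :=
  bending (fun u => γ u t) s

/-- `γ` is a solution of the LIEN flow on `J × I`: a smooth one-parameter family of null curves such
that `∂ₜγ = 2 ∂ₛ³γ - 6 κ ∂ₛγ`. -/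
structure IsLIENSolution (J I : Set ℝ) (γ : ℝ → ℝ → SL(2, ℝ)) : Prop where
  smooth : ContDiffOn ℝ ∞ (fun p : ℝ × ℝ => (γ p.1 p.2 : Mat2)) (J ×ˢ I)
  nullCurve : ∀ t ∈ I, IsNullCurve J fun s => γ s t
  flow : ∀ s ∈ J, ∀ t ∈ I,
    deriv (fun τ => (γ s τ : Mat2)) t =
      (2 : ℝ) • curveDeriv 3 (fun u => γ u t) s -
        (6 * familyBending γ s t) • curveDeriv 1 (fun u => γ u t) s

/-- `κ` is a smooth solution of the KdV equation `∂ₜκ + ∂ₛ³κ - 6 κ ∂ₛκ = 0` on `J × I`. -/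
structure IsKdVSolution (J I : Set ℝ) (κ : ℝ → ℝ → ℝ) : Prop where
  smooth : ContDiffOn ℝ ∞ (fun p : ℝ × ℝ => κ p.1 p.2) (J ×ˢ I)
  kdv : ∀ s ∈ J, ∀ t ∈ I,
    deriv (fun τ => κ s τ) t + iteratedDeriv 3 (fun u => κ u t) s
      - 6 * κ s t * deriv (fun u => κ u t) s = 0

/-- `f` is a solution on `J × I` of the Wahlquist-Estabrook equation with spectral parameter `lam`,
`df = (κ - f² + lam) ds
  + (4 lam (f² - lam) - 2 κ (f² + lam) + 2 κ² + 2 f ∂ₛκ - ∂ₛ²κ) dt`. -/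
def IsWahlquistEstabrookSolution (J I : Set ℝ) (κ : ℝ → ℝ → ℝ) (lam : ℝ)
    (f : ℝ → ℝ → ℝ) : Prop :=
  ∀ s ∈ J, ∀ t ∈ I,
    HasFDerivAt (fun p : ℝ × ℝ => f p.1 p.2)
      ((κ s t - f s t ^ 2 + lam) • ContinuousLinearMap.fst ℝ ℝ ℝ +
        (4 * lam * (f s t ^ 2 - lam) - 2 * κ s t * (f s t ^ 2 + lam) + 2 * κ s t ^ 2
          + 2 * f s t * deriv (fun u => κ u t) s
          - iteratedDeriv 2 (fun u => κ u t) s) • ContinuousLinearMap.snd ℝ ℝ ℝ)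
      (s, t)

/-- `κ'` is the Bäcklund transform, on `J × I`, of the solution `κ` of the KdV equation with spectral
parameter `lam ≠ 0` and transforming function `f`. -/
def IsBacklundTransform (J I : Set ℝ) (κ : ℝ → ℝ → ℝ) (lam : ℝ) (f κ' : ℝ → ℝ → ℝ) : Prop :=
  IsKdVSolution J I κ ∧ lam ≠ 0 ∧
  ∀ s ∈ J, ∀ t ∈ I, κ' s t = -κ s t + 2 * f s t ^ 2 - 2 * lam

end NullCurveKdV

end

namespace NullCurveKdV

/-! In a spinor frame every derivative of `γ` has the form `F₊ A F₋⁻¹`, and the product rule turns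
`A` into `K₊ A + A' - A K₋`. Starting from `A = 1` this gives explicit matrices for `γ', γ'', γ'''`,
and the sequence closes up as `γ'''' = -4γ + 2κ'γ' + 4κγ''`. Left and right multiplication by `SL(2,
ℝ)` preserves the inner product, so metric conditions become computations with these matrices.

The transform is a gauge change. Up to sign, `transformMatrix` is `D₊ D₋⁻¹` with Darboux matrices
`D± = c± [[-f, f² - μ±], [1, -f]]`, where `μ± = λ ∓ 1` and `c±² μ± = 1`. The Riccati equation is
what makes `F± D±` satisfy the Frenet equations with `κ̃ = -κ + 2f² - 2λ`, the same function for
both signs (`hasDerivAt_mul_darbouxMatrix`). Part 1 and the formula for the new bending follow.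

For the flow, `γ̃ = m (λγ - fγ' + γ''/2)` with `m` constant. Since `∂ₜ` and `∂ₛ` commute, `∂ₜγ⁽ⁿ⁾ =
∂ₛⁿ(2γ''' - 6κγ')`, which the fourth-order equation rewrites in the jet `γ, γ', γ'', γ'''`. The case
`n = 3`, paired with `γ'''`, yields KdV (`IsLIENSolution.isKdVSolution`). The cases `n ≤ 2`, with
the `dt` part of the Wahlquist–Estabrook equation, give `∂ₜγ̃`, whose coefficients agree with those
of `2γ̃''' - 6κ̃γ̃'` (`IsLIENSolution.of_jetCombination`). -/

/-! ### Derivatives of curves of matrices -/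

theorem hasDerivAt_matrix_iff {P : ℝ → Mat2} {P' : Mat2} {s : ℝ} :
    HasDerivAt P P' s ↔ ∀ i j, HasDerivAt (fun u => P u i j) (P' i j) s := by
  refine (hasDerivAt_pi (φ := P) (φ' := P')).trans (forall_congr' fun i => ?_)
  exact hasDerivAt_pi

/-- The adjugate replaces the inverse on `SL(2, ℝ)` and is linear in the entries for `2 × 2`
matrices. For traceless `L`, `adj L = -L`, so `Q' = QL` gives `(adj Q)' = -L adj Q`. -/
theorem hasDerivAt_mul_mul_adjugate {P A Q : ℝ → Mat2} {K L B : Mat2} {s : ℝ}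
    (hP : HasDerivAt P (P s * K) s) (hA : HasDerivAt A B s) (hQ : HasDerivAt Q (Q s * L) s)
    (hL : L 1 1 = -L 0 0) :
    HasDerivAt (fun u => P u * A u * (Q u).adjugate)
      (P s * (K * A s + B - A s * L) * (Q s).adjugate) s := by
  rw [hasDerivAt_matrix_iff] at *
  simp only [Matrix.adjugate_fin_two, Matrix.mul_apply, Fin.sum_univ_two] at *
  intro i j
  -- `x, y` stand for the two entries of one column of `adj Q`, so that a single product rule serves
  -- both columns.
  have key : ∀ x y : ℝ → ℝ, ∀ x' y' : ℝ, HasDerivAt x x' s → HasDerivAt y y' s →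
    HasDerivAt (fun u => ∑ k, ((P u i 0 * A u 0 k + P u i 1 * A u 1 k) * ![x u, y u] k))
     (((P s i 0 * K 0 0 + P s i 1 * K 1 0) * A s 0 0 + P s i 0 * B 0 0 +
        ((P s i 0 * K 0 1 + P s i 1 * K 1 1) * A s 1 0 + P s i 1 * B 1 0)) * x s +
      (P s i 0 * A s 0 0 + P s i 1 * A s 1 0) * x' +
      (((P s i 0 * K 0 0 + P s i 1 * K 1 0) * A s 0 1 + P s i 0 * B 0 1 +
        ((P s i 0 * K 0 1 + P s i 1 * K 1 1) * A s 1 1 + P s i 1 * B 1 1)) * y s +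
      (P s i 0 * A s 0 1 + P s i 1 * A s 1 1) * y')) s := by
    intro x y x' y' hx hy
    simp only [Fin.sum_univ_two, Matrix.cons_val_zero, Matrix.cons_val_one]
    exact ((((hP i 0).mul (hA 0 0)).add ((hP i 1).mul (hA 1 0))).mul hx).add
      ((((hP i 0).mul (hA 0 1)).add ((hP i 1).mul (hA 1 1))).mul hy)
  fin_cases j
  · refine (key (fun u => Q u 1 1) (fun u => -Q u 1 0) _ _ (hQ 1 1) (hQ 1 0).neg).congr_deriv ?_ |>.congr_of_eventuallyEq (.of_forall fun u => ?_) 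
    · simp [Matrix.mul_apply, Fin.sum_univ_two, hL]; ring
    · simp [Fin.sum_univ_two]
  · refine (key (fun u => -Q u 0 1) (fun u => Q u 0 0) _ _ (hQ 0 1).neg (hQ 0 0)).congr_deriv ?_ |>.congr_of_eventuallyEq (.of_forall fun u => ?_) 
    · simp [Matrix.mul_apply, Fin.sum_univ_two, hL]; ring
    · simp [Fin.sum_univ_two]

/-! ### Partial derivatives and their commutation -/

variable {E : Type*} [NormedAddCommGroup E] [NormedSpace ℝ E]

/-- The partial derivative in the first variable. -/
noncomputable def partialS (g : ℝ × ℝ → E) (p : ℝ × ℝ) : E := fderiv ℝ g p (1, 0)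

/-- The partial derivative in the second variable. -/
noncomputable def partialT (g : ℝ × ℝ → E) (p : ℝ × ℝ) : E := fderiv ℝ g p (0, 1)

theorem contDiffOn_partialS {U : Set (ℝ × ℝ)} (hU : IsOpen U) {g : ℝ × ℝ → E}
    (hg : ContDiffOn ℝ ∞ g U) : ContDiffOn ℝ ∞ (partialS g) U :=
  (hg.fderiv_of_isOpen hU (m := ∞) (by simp)).clm_apply contDiffOn_const

theorem contDiffOn_partialT {U : Set (ℝ × ℝ)} (hU : IsOpen U) {g : ℝ × ℝ → E}
    (hg : ContDiffOn ℝ ∞ g U) : ContDiffOn ℝ ∞ (partialT g) U :=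
  (hg.fderiv_of_isOpen hU (m := ∞) (by simp)).clm_apply contDiffOn_const

theorem contDiffOn_iterate_partialS {U : Set (ℝ × ℝ)} (hU : IsOpen U) {g : ℝ × ℝ → E}
    (hg : ContDiffOn ℝ ∞ g U) (n : ℕ) : ContDiffOn ℝ ∞ (partialS^[n] g) U := by
  induction n with
  | zero => exact hg
  | succ n ih => rw [Function.iterate_succ_apply']; exact contDiffOn_partialS hU ih

theorem differentiableAt_of_contDiffOn {F : Type*} [NormedAddCommGroup F] [NormedSpace ℝ F]
    {U : Set F} (hU : IsOpen U) {g : F → E} (hg : ContDiffOn ℝ ∞ g U) {p : F} (hp : p ∈ U) :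
    DifferentiableAt ℝ g p :=
  (hg.contDiffAt (hU.mem_nhds hp)).differentiableAt (by simp)

theorem _root_.DifferentiableAt.hasDerivAt_partialS {g : ℝ × ℝ → E} {s t : ℝ}
    (hg : DifferentiableAt ℝ g (s, t)) :
    HasDerivAt (fun u => g (u, t)) (partialS g (s, t)) s :=
  hg.hasFDerivAt.comp_hasDerivAt s ((hasDerivAt_id s).prodMk (hasDerivAt_const s t))

theorem _root_.DifferentiableAt.hasDerivAt_partialT {g : ℝ × ℝ → E} {s t : ℝ}
    (hg : DifferentiableAt ℝ g (s, t)) :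
    HasDerivAt (fun u => g (s, u)) (partialT g (s, t)) t :=
  hg.hasFDerivAt.comp_hasDerivAt t ((hasDerivAt_const t s).prodMk (hasDerivAt_id t))

theorem partialS_congr {U : Set (ℝ × ℝ)} (hU : IsOpen U) {g h : ℝ × ℝ → E}
    (hgh : Set.EqOn g h U) : Set.EqOn (partialS g) (partialS h) U := fun p hp => by
  have : g =ᶠ[nhds p] h := hgh.eventuallyEq_of_mem (hU.mem_nhds hp)
  rw [partialS, partialS, this.fderiv_eq]

theorem partialT_partialS {U : Set (ℝ × ℝ)} (hU : IsOpen U) {g : ℝ × ℝ → E}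
    (hg : ContDiffOn ℝ ∞ g U) : Set.EqOn (partialT (partialS g)) (partialS (partialT g)) U := by
  intro p hp
  have hsymm : IsSymmSndFDerivAt ℝ g p :=
    (hg.contDiffAt (hU.mem_nhds hp)).isSymmSndFDerivAt (by simpa using WithTop.coe_le_coe.2 (le_top : (2 : ℕ∞) ≤ ⊤))
  have hd : DifferentiableAt ℝ (fderiv ℝ g) p :=
    differentiableAt_of_contDiffOn hU (hg.fderiv_of_isOpen hU (m := ∞) (by simp)) hp
  have h (v w : ℝ × ℝ) : fderiv ℝ (fun q => fderiv ℝ g q v) p w = fderiv ℝ (fderiv ℝ g) p w v := by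
    rw [fderiv_clm_apply hd (differentiableAt_const v)]; simp
  change fderiv ℝ (fun q => fderiv ℝ g q (1, 0)) p (0, 1) =
    fderiv ℝ (fun q => fderiv ℝ g q (0, 1)) p (1, 0)
  rw [h, h]; exact hsymm _ _

/-- Repeated use of the symmetry of second derivatives; it converts the flow equation for `γ` into
evolution equations for all its `s`-derivatives. -/
theorem partialT_iterate_partialS {U : Set (ℝ × ℝ)} (hU : IsOpen U) {g : ℝ × ℝ → E}
    (hg : ContDiffOn ℝ ∞ g U) (n : ℕ) :
    Set.EqOn (partialT (partialS^[n] g)) (partialS^[n] (partialT g)) U := by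
  induction n with
  | zero => intro p _; rfl
  | succ n ih =>
    simp only [Function.iterate_succ_apply']
    exact (partialT_partialS hU (contDiffOn_iterate_partialS hU hg n)).trans
      (partialS_congr hU ih)

theorem iteratedDeriv_eq_iterate_partialS {J I : Set ℝ} (hJ : IsOpen J) (hI : IsOpen I)
    {g : ℝ × ℝ → E} (hg : ContDiffOn ℝ ∞ g (J ×ˢ I)) (n : ℕ) {s t : ℝ} (hs : s ∈ J) (ht : t ∈ I) :
    iteratedDeriv n (fun u => g (u, t)) s = partialS^[n] g (s, t) := by
  induction n generalizing s with
  | zero => simp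
  | succ n ih =>
    rw [iteratedDeriv_succ, Function.iterate_succ_apply']
    have h : iteratedDeriv n (fun u => g (u, t)) =ᶠ[nhds s] fun u => partialS^[n] g (u, t) := by
      filter_upwards [hJ.mem_nhds hs] with u hu using ih hu
    rw [h.deriv_eq]
    exact (differentiableAt_of_contDiffOn (hJ.prod hI) (contDiffOn_iterate_partialS (hJ.prod hI)
      hg n) ⟨hs, ht⟩).hasDerivAt_partialS.deriv


/-! ### Smoothness by bootstrapping -/

section Smoothness

variable {E F : Type*} [NormedAddCommGroup E] [NormedSpace ℝ E] [NormedAddCommGroup F]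
  [NormedSpace ℝ F]

/-- Differentiability gives `C⁰`, and if `g` is `Cⁿ` then so is its derivative, hence `g` is `Cⁿ⁺¹`.
This supplies the smoothness of the frames and of `f`, whose definitions ask only for
differentiability. -/
theorem contDiffOn_infty_of_hasFDerivAt_of_bootstrap {U : Set E} (hU : IsOpen U) {g : E → F}
    {g' : E → E →L[ℝ] F} (hg : ∀ p ∈ U, HasFDerivAt g (g' p) p)
    (hboot : ∀ n : ℕ, ContDiffOn ℝ n g U → ContDiffOn ℝ n g' U) : ContDiffOn ℝ ∞ g U := by
  rw [contDiffOn_infty]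
  intro n
  induction n with
  | zero =>
    rw [Nat.cast_zero, contDiffOn_zero]
    exact fun p hp => (hg p hp).continuousAt.continuousWithinAt
  | succ n ih =>
    rw [Nat.cast_succ, contDiffOn_succ_iff_fderiv_of_isOpen hU]
    refine ⟨fun p hp => (hg p hp).differentiableAt.differentiableWithinAt, by simp, ?_⟩
    exact (hboot n ih).congr fun p hp => (hg p hp).fderiv

theorem contDiffOn_infty_of_hasDerivAt_of_bootstrap {J : Set ℝ} (hJ : IsOpen J) {g g' : ℝ → F}
    (hg : ∀ s ∈ J, HasDerivAt g (g' s) s)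
    (hboot : ∀ n : ℕ, ContDiffOn ℝ n g J → ContDiffOn ℝ n g' J) : ContDiffOn ℝ ∞ g J :=
  contDiffOn_infty_of_hasFDerivAt_of_bootstrap hJ (fun s hs => (hg s hs).hasFDerivAt)
    fun n hn => (ContinuousLinearMap.toSpanSingletonLIE ℝ F).toContinuousLinearEquiv.contDiff.comp_contDiffOn
      (hboot n hn)

theorem contDiffOn_matrix_iff {n : WithTop ℕ∞} {P : E → Mat2} {U : Set E} :
    ContDiffOn ℝ n P U ↔ ∀ i j, ContDiffOn ℝ n (fun u => P u i j) U := by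
  refine (contDiffOn_pi (Φ := P)).trans (forall_congr' fun i => ?_)
  exact contDiffOn_pi

theorem contDiffOn_adsInner {n : WithTop ℕ∞} {P Q : E → Mat2} {U : Set E}
    (hP : ContDiffOn ℝ n P U) (hQ : ContDiffOn ℝ n Q U) :
    ContDiffOn ℝ n (fun u => adsInner (P u) (Q u)) U := by
  rw [contDiffOn_matrix_iff] at hP hQ
  exact (((((hP 0 1).mul (hQ 1 0)).add ((hP 1 0).mul (hQ 0 1))).sub
    ((hP 0 0).mul (hQ 1 1))).sub ((hP 1 1).mul (hQ 0 0))).div_const 2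

end Smoothness

/-! ### The inner product and bivectors -/

theorem adsInner_smul_add_smul_left (a b : ℝ) (U V W : Mat2) :
    adsInner (a • U + b • V) W = a * adsInner U W + b * adsInner V W := by
  simp [adsInner]; ring

theorem adsInner_comm (U V : Mat2) : adsInner U V = adsInner V U := by
  unfold adsInner; ring

/-- The quadratic form is `-det`, and `X ↦ P X adj Q` multiplies determinants by `det P det Q = 1`.
-/
theorem adsInner_conj (P Q : SL(2, ℝ)) (X Y : Mat2) :
    adsInner ((P : Mat2) * X * (Q : Mat2).adjugate) ((P : Mat2) * Y * (Q : Mat2).adjugate) =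
      adsInner X Y := by
  have hP := P.det_coe
  have hQ := Q.det_coe
  have h : adsInner ((P : Mat2) * X * (Q : Mat2).adjugate)
      ((P : Mat2) * Y * (Q : Mat2).adjugate) =
      (P : Mat2).det * (Q : Mat2).det * adsInner X Y := by
    simp only [adsInner, Matrix.adjugate_fin_two, Matrix.det_fin_two, Matrix.mul_apply,
      Fin.sum_univ_two, Matrix.of_apply, Matrix.cons_val', Matrix.cons_val_zero,
      Matrix.cons_val_one, Matrix.cons_val_fin_one]
    ring
  rw [h, hP, hQ]; ring

theorem linearCombination_conj (a b c : ℝ) (P Q X Y Z : Mat2) :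
    a • (P * X * Q) + b • (P * Y * Q) + c • (P * Z * Q) = P * (a • X + b • Y + c • Z) * Q := by
  simp only [mul_add, add_mul, Matrix.mul_smul, Matrix.smul_mul]

theorem linearIndependent_pair_of_adsInner {U V : Mat2} (hU : adsInner U U ≠ 0)
    (hUV : adsInner U V = 0) (hV : V ≠ 0) : LinearIndependent ℝ ![U, V] := by
  rw [LinearIndependent.pair_iff]
  intro a b h
  have h1 := adsInner_smul_add_smul_left a b U V U
  rw [h, adsInner_comm V U, hUV] at h1
  have h0 : adsInner 0 U = 0 := by simp [adsInner]
  have ha : a = 0 := by simpa [h0, hU] using h1.symm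
  subst ha
  exact ⟨rfl, by simpa [hV] using h⟩

/-- On `aU + bV` the form is `-a²`, with radical spanned by `V`. -/
theorem isTypeNegZero_of_adsInner {U V : Mat2} (hU : adsInner U U = -1)
    (hUV : adsInner U V = 0) (hV : adsInner V V = 0) (hV' : V ≠ 0) : IsTypeNegZero U V := by
  refine ⟨linearIndependent_pair_of_adsInner (by rw [hU]; norm_num) hUV hV', ?_,
    ⟨U, Submodule.subset_span (by simp), by rw [hU]; norm_num⟩,
    V, Submodule.subset_span (by simp), hV', ?_⟩
  · intro X hX
    obtain ⟨a, b, rfl⟩ := Submodule.mem_span_pair.1 hX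
    rw [adsInner_smul_add_smul_left, adsInner_comm U, adsInner_comm V,
      adsInner_smul_add_smul_left, adsInner_smul_add_smul_left, adsInner_comm V U, hU, hUV, hV]
    nlinarith [sq_nonneg a]
  · intro Y hY
    obtain ⟨a, b, rfl⟩ := Submodule.mem_span_pair.1 hY
    rw [adsInner_comm, adsInner_smul_add_smul_left, hUV, hV]
    ring

theorem sq_add_sq_pos (P : SL(2, ℝ)) : 0 < (P : Mat2) 0 0 ^ 2 + (P : Mat2) 1 0 ^ 2 := by
  have hP := P.det_coe
  rw [Matrix.det_fin_two] at hP
  by_contra! h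
  have h0 : (P : Mat2) 0 0 = 0 := by nlinarith [sq_nonneg ((P : Mat2) 0 0), sq_nonneg ((P : Mat2) 1 0)]
  have h1 : (P : Mat2) 1 0 = 0 := by nlinarith [sq_nonneg ((P : Mat2) 0 0), sq_nonneg ((P : Mat2) 1 0)]
  rw [h0, h1] at hP
  norm_num at hP

/-- The reference bivector is not invariant under `SL(2, ℝ) × SL(2, ℝ)`, so `adsInner_conj` does not
apply. Using both determinant conditions, the pairing equals half the sum of the squared lengths of
the first columns of `P` and `Q`. -/
theorem bivectorInner_conj_pos (P Q : SL(2, ℝ)) :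
    0 < bivectorInner !![1, 0; 0, 1] !![0, 1; -1, 0] ((P : Mat2) * 1 * (Q : Mat2).adjugate)
      ((P : Mat2) * !![0, 2; 0, 0] * (Q : Mat2).adjugate) := by
  have hP := P.det_coe
  have hQ := Q.det_coe
  rw [Matrix.det_fin_two] at hP hQ
  have h1 := sq_add_sq_pos P
  have h2 := sq_add_sq_pos Q
  have h : bivectorInner !![1, 0; 0, 1] !![0, 1; -1, 0] ((P : Mat2) * 1 * (Q : Mat2).adjugate)
      ((P : Mat2) * !![0, 2; 0, 0] * (Q : Mat2).adjugate) =
      ((P : Mat2) 0 0 ^ 2 + (P : Mat2) 1 0 ^ 2 + ((Q : Mat2) 0 0 ^ 2 + (Q : Mat2) 1 0 ^ 2)) / 2 := by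
    simp only [bivectorInner, adsInner, Matrix.adjugate_fin_two, Matrix.mul_apply, mul_one,
      Fin.sum_univ_two, Matrix.of_apply, Matrix.cons_val', Matrix.cons_val_zero,
      Matrix.cons_val_one, Matrix.cons_val_fin_one]
    linear_combination ((Q : Mat2) 0 0 ^ 2 + (Q : Mat2) 1 0 ^ 2) / 2 * hP +
      ((P : Mat2) 0 0 ^ 2 + (P : Mat2) 1 0 ^ 2) / 2 * hQ
  rw [h]; linarith

/-! ### Frenet frames and the geometry of the curve they define -/

/-- `(Fp, Fm)` is a lift of `γ` on `J` that satisfies the spinorial Frenet equations with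
coefficient `k`. -/
structure IsFrenetFrame (J : Set ℝ) (k : ℝ → ℝ) (γ Fp Fm : ℝ → SL(2, ℝ)) : Prop where
  lift : ∀ s ∈ J, γ s = Fp s * (Fm s)⁻¹
  pos : ∀ s ∈ J, HasDerivAt (fun u => (Fp u : Mat2)) ((Fp s : Mat2) * !![0, k s + 1; 1, 0]) s
  neg : ∀ s ∈ J, HasDerivAt (fun u => (Fm u : Mat2)) ((Fm s : Mat2) * !![0, k s - 1; 1, 0]) s

theorem IsSpinorFrame.isFrenetFrame {J : Set ℝ} {γ Fp Fm : ℝ → SL(2, ℝ)}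
    (h : IsSpinorFrame J γ Fp Fm) : IsFrenetFrame J (bending γ) γ Fp Fm :=
  ⟨h.lift, h.frenet_pos, h.frenet_neg⟩

theorem contDiffOn_of_frenet {J : Set ℝ} (hJ : IsOpen J) {F : ℝ → SL(2, ℝ)} {h : ℝ → ℝ}
    (hh : ContDiffOn ℝ ∞ h J)
    (hF : ∀ s ∈ J, HasDerivAt (fun u => (F u : Mat2)) ((F s : Mat2) * !![0, h s; 1, 0]) s) :
    ContDiffOn ℝ ∞ (fun u => (F u : Mat2)) J := by
  refine contDiffOn_infty_of_hasDerivAt_of_bootstrap hJ hF fun n hn => ?_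
  rw [contDiffOn_matrix_iff] at hn ⊢
  intro i j
  have hh' : ContDiffOn ℝ n h J := hh.of_le (mod_cast le_top)
  fin_cases j
  · simpa [Matrix.mul_apply, Fin.sum_univ_two] using hn i 1
  · simpa [Matrix.mul_apply, Fin.sum_univ_two] using (hn i 0).mul hh'

theorem curveDeriv_succ (n : ℕ) (γ : ℝ → SL(2, ℝ)) :
    curveDeriv (n + 1) γ = deriv (curveDeriv n γ) := iteratedDeriv_succ

namespace IsFrenetFrame

variable {J : Set ℝ} {k : ℝ → ℝ} {γ Fp Fm : ℝ → SL(2, ℝ)}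

theorem coe_eq (h : IsFrenetFrame J k γ Fp Fm) {s : ℝ} (hs : s ∈ J) :
    (γ s : Mat2) = (Fp s : Mat2) * 1 * (Fm s : Mat2).adjugate := by
  rw [h.lift s hs, Matrix.SpecialLinearGroup.coe_mul, Matrix.SpecialLinearGroup.coe_inv, mul_one]

theorem hasDerivAt_curveDeriv (hJ : IsOpen J) (h : IsFrenetFrame J k γ Fp Fm) {n : ℕ}
    {A : ℝ → Mat2} {B : Mat2} {s : ℝ} (hs : s ∈ J)
    (hn : ∀ u ∈ J, curveDeriv n γ u = (Fp u : Mat2) * A u * (Fm u : Mat2).adjugate)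
    (hA : HasDerivAt A B s) :
    HasDerivAt (curveDeriv n γ) ((Fp s : Mat2) * (!![0, k s + 1; 1, 0] * A s + B -
      A s * !![0, k s - 1; 1, 0]) * (Fm s : Mat2).adjugate) s := by
  refine (hasDerivAt_mul_mul_adjugate (h.pos s hs) hA (h.neg s hs) (by simp)).congr_of_eventuallyEq ?_
  filter_upwards [hJ.mem_nhds hs] with u hu using hn u hu

theorem curveDeriv_zero (h : IsFrenetFrame J k γ Fp Fm) {s : ℝ} (hs : s ∈ J) :
    curveDeriv 0 γ s = (Fp s : Mat2) * 1 * (Fm s : Mat2).adjugate := by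
  rw [curveDeriv, iteratedDeriv_zero, h.coe_eq hs]

theorem curveDeriv_one (hJ : IsOpen J) (h : IsFrenetFrame J k γ Fp Fm) {s : ℝ} (hs : s ∈ J) :
    curveDeriv 1 γ s = (Fp s : Mat2) * !![0, 2; 0, 0] * (Fm s : Mat2).adjugate := by
  rw [curveDeriv_succ]
  refine (h.hasDerivAt_curveDeriv hJ hs (fun u hu => h.curveDeriv_zero hu)
    (hasDerivAt_const s 1)).deriv.trans ?_
  congr 2
  ext i j; fin_cases i <;> fin_cases j <;> simp
  norm_num

theorem curveDeriv_two (hJ : IsOpen J) (h : IsFrenetFrame J k γ Fp Fm) {s : ℝ} (hs : s ∈ J) :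
    curveDeriv 2 γ s = (Fp s : Mat2) * !![-2, 0; 0, 2] * (Fm s : Mat2).adjugate := by
  rw [curveDeriv_succ]
  refine (h.hasDerivAt_curveDeriv hJ hs (fun u hu => h.curveDeriv_one hJ hu)
    (hasDerivAt_const s _)).deriv.trans ?_
  congr 2
  ext i j; fin_cases i <;> fin_cases j <;> simp

theorem curveDeriv_three (hJ : IsOpen J) (h : IsFrenetFrame J k γ Fp Fm) {s : ℝ} (hs : s ∈ J) :
    curveDeriv 3 γ s = (Fp s : Mat2) * !![0, 4 * k s; -4, 0] * (Fm s : Mat2).adjugate := by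
  rw [curveDeriv_succ]
  refine (h.hasDerivAt_curveDeriv hJ hs (fun u hu => h.curveDeriv_two hJ hu)
    (hasDerivAt_const s _)).deriv.trans ?_
  congr 2
  ext i j; fin_cases i <;> fin_cases j <;> simp <;> ring

/-- The matrices of `γ, γ', γ'', γ'''` span all `2 × 2` matrices, so the fourth derivative must be a
combination of these; the coefficient of `γ'''` vanishes. -/
theorem hasDerivAt_curveDeriv_three (hJ : IsOpen J) (h : IsFrenetFrame J k γ Fp Fm) {s k' : ℝ}
    (hs : s ∈ J) (hk : HasDerivAt k k' s) :
    HasDerivAt (curveDeriv 3 γ) ((-4 : ℝ) • curveDeriv 0 γ s + (2 * k') • curveDeriv 1 γ s +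
      (4 * k s) • curveDeriv 2 γ s) s := by
  have hA : HasDerivAt (fun u => !![0, 4 * k u; -4, 0]) !![0, 4 * k'; 0, 0] s := by
    rw [hasDerivAt_matrix_iff]
    intro i j
    fin_cases i <;> fin_cases j
    · exact hasDerivAt_const _ _
    · exact hk.const_mul 4
    · exact hasDerivAt_const _ _
    · exact hasDerivAt_const _ _
  refine (h.hasDerivAt_curveDeriv hJ hs (fun u hu => h.curveDeriv_three hJ hu) hA).congr_deriv ?_
  rw [h.curveDeriv_zero hs, h.curveDeriv_one hJ hs, h.curveDeriv_two hJ hs]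
  rw [linearCombination_conj]
  congr 2
  ext i j; fin_cases i <;> fin_cases j <;> simp <;> ring

/-- The coefficient of a Frenet system is forced to be the bending, so any such system is a spinor
frame. The bending of the transform is read off in this way from its gauge-transformed frame. -/
theorem bending_eq (hJ : IsOpen J) (h : IsFrenetFrame J k γ Fp Fm) {s : ℝ} (hs : s ∈ J) :
    bending γ s = k s := by
  rw [bending, h.curveDeriv_three hJ hs, adsInner_conj]
  simp [adsInner]; ring

theorem isSpinorFrame (hJ : IsOpen J) (h : IsFrenetFrame J k γ Fp Fm) :
    IsSpinorFrame J γ Fp Fm where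
  lift := h.lift
  frenet_pos s hs := by rw [h.bending_eq hJ hs]; exact h.pos s hs
  frenet_neg s hs := by rw [h.bending_eq hJ hs]; exact h.neg s hs

theorem contDiffOn_pos (hJ : IsOpen J) (hk : ContDiffOn ℝ ∞ k J) (h : IsFrenetFrame J k γ Fp Fm) :
    ContDiffOn ℝ ∞ (fun u => (Fp u : Mat2)) J :=
  contDiffOn_of_frenet hJ (hk.add contDiffOn_const) h.pos

theorem contDiffOn_neg (hJ : IsOpen J) (hk : ContDiffOn ℝ ∞ k J) (h : IsFrenetFrame J k γ Fp Fm) :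
    ContDiffOn ℝ ∞ (fun u => (Fm u : Mat2)) J :=
  contDiffOn_of_frenet hJ (hk.sub contDiffOn_const) h.neg

theorem isNullCurve (hJ : IsOpen J) (hk : ContDiffOn ℝ ∞ k J) (h : IsFrenetFrame J k γ Fp Fm) :
    IsNullCurve J γ := by
  -- `γ'` is null, so its own norm cannot show that it is nonzero; its pairing with `γ'''` is the
  -- constant `-4`.
  have himm : ∀ s ∈ J, curveDeriv 1 γ s ≠ 0 := by
    intro s hs h0
    have h1 : adsInner (curveDeriv 1 γ s) (curveDeriv 3 γ s) = -4 := by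
      rw [h.curveDeriv_one hJ hs, h.curveDeriv_three hJ hs, adsInner_conj]
      simp [adsInner]; norm_num
    rw [h0] at h1
    simp [adsInner] at h1
  have hnull : ∀ s ∈ J, adsInner (curveDeriv 1 γ s) (curveDeriv 1 γ s) = 0 := by
    intro s hs
    rw [h.curveDeriv_one hJ hs, adsInner_conj]
    simp [adsInner]
  have hpt : ∀ s ∈ J, adsInner (curveDeriv 2 γ s) (curveDeriv 2 γ s) = 4 := by
    intro s hs
    rw [h.curveDeriv_two hJ hs, adsInner_conj]
    simp [adsInner]; norm_num
  refine ⟨?_, himm, hnull, fun s hs => ⟨?_, ?_⟩, fun s hs => ?_, hpt⟩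
  · have hP := h.contDiffOn_pos hJ hk
    have hM := h.contDiffOn_neg hJ hk
    rw [contDiffOn_matrix_iff] at *
    intro i j
    refine ContDiffOn.congr (f := fun s => (Fp s : Mat2) i 0 * (Fm s : Mat2).adjugate 0 j +
      (Fp s : Mat2) i 1 * (Fm s : Mat2).adjugate 1 j) ?_ fun s hs => by
        rw [h.coe_eq hs, mul_one, Matrix.mul_apply, Fin.sum_univ_two]
    simp only [Matrix.adjugate_fin_two]
    fin_cases j
    · exact ((hP i 0).mul (hM 1 1)).add ((hP i 1).mul (hM 1 0).neg)
    · exact ((hP i 0).mul (hM 0 1).neg).add ((hP i 1).mul (hM 0 0))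
  · refine isTypeNegZero_of_adsInner ?_ ?_ (hnull s hs) (himm s hs)
    · rw [h.coe_eq hs, adsInner_conj]; simp [adsInner]; norm_num
    · rw [h.coe_eq hs, h.curveDeriv_one hJ hs, adsInner_conj]; simp [adsInner]
  · rw [h.coe_eq hs, h.curveDeriv_one hJ hs]
    exact bivectorInner_conj_pos _ _
  · rw [LinearIndependent.pair_symm_iff]
    refine linearIndependent_pair_of_adsInner (by rw [hpt s hs]; norm_num) ?_ (himm s hs)
    rw [h.curveDeriv_one hJ hs, h.curveDeriv_two hJ hs, adsInner_conj]
    simp [adsInner]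

/-- This and the next three pairings with `γ'''` are what the time derivative of `⟨γ''', γ'''⟩`
requires. -/
theorem adsInner_curveDeriv_zero_three (hJ : IsOpen J) (h : IsFrenetFrame J k γ Fp Fm) {s : ℝ}
    (hs : s ∈ J) : adsInner (curveDeriv 0 γ s) (curveDeriv 3 γ s) = 0 := by
  rw [h.curveDeriv_zero hs, h.curveDeriv_three hJ hs, adsInner_conj]; simp [adsInner]

theorem adsInner_curveDeriv_one_three (hJ : IsOpen J) (h : IsFrenetFrame J k γ Fp Fm) {s : ℝ}
    (hs : s ∈ J) : adsInner (curveDeriv 1 γ s) (curveDeriv 3 γ s) = -4 := by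
  rw [h.curveDeriv_one hJ hs, h.curveDeriv_three hJ hs, adsInner_conj]; simp [adsInner]; norm_num

theorem adsInner_curveDeriv_two_three (hJ : IsOpen J) (h : IsFrenetFrame J k γ Fp Fm) {s : ℝ}
    (hs : s ∈ J) : adsInner (curveDeriv 2 γ s) (curveDeriv 3 γ s) = 0 := by
  rw [h.curveDeriv_two hJ hs, h.curveDeriv_three hJ hs, adsInner_conj]; simp [adsInner]

theorem adsInner_curveDeriv_three_three (hJ : IsOpen J) (h : IsFrenetFrame J k γ Fp Fm) {s : ℝ}
    (hs : s ∈ J) : adsInner (curveDeriv 3 γ s) (curveDeriv 3 γ s) = -16 * k s := by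
  rw [h.curveDeriv_three hJ hs, adsInner_conj]; simp [adsInner]; ring

end IsFrenetFrame


/-! ### The Darboux transform of a single null curve -/

/-- The Darboux matrix `c [[-y, y² - μ], [1, -y]]`, of determinant one for `c² μ = 1`. -/
def darbouxMatrix (c μ y : ℝ) (h : c ^ 2 * μ = 1) : SL(2, ℝ) :=
  ⟨!![-(c * y), c * (y ^ 2 - μ); c, -(c * y)], by
    rw [Matrix.det_fin_two_of]; linear_combination h⟩

/-- The Riccati equation amounts to the gauge identity `K D + D' = D K̃`. Apart from the shift `e`,
the new coefficient does not involve `e`, so one `f` transforms both spinor components (`e = 1` and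
`e = -1`). -/
theorem hasDerivAt_mul_darbouxMatrix {F : ℝ → SL(2, ℝ)} {f k : ℝ → ℝ} {c lam e s : ℝ}
    (h : c ^ 2 * (lam - e) = 1)
    (hF : HasDerivAt (fun u => (F u : Mat2)) ((F s : Mat2) * !![0, k s + e; 1, 0]) s)
    (hf : HasDerivAt f (k s + lam - f s ^ 2) s) :
    HasDerivAt (fun u => ((F u * darbouxMatrix c (lam - e) (f u) h : SL(2, ℝ)) : Mat2))
      (((F s * darbouxMatrix c (lam - e) (f s) h : SL(2, ℝ)) : Mat2) *
        !![0, (-k s + 2 * f s ^ 2 - 2 * lam) + e; 1, 0]) s := by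
  have hA : HasDerivAt (fun u => (darbouxMatrix c (lam - e) (f u) h : Mat2))
      !![-(c * (k s + lam - f s ^ 2)), c * (2 * f s * (k s + lam - f s ^ 2));
        0, -(c * (k s + lam - f s ^ 2))] s := by
    rw [hasDerivAt_matrix_iff]
    intro i j
    fin_cases i <;> fin_cases j
    · exact (hf.const_mul c).neg
    · exact ((((hf.pow 2).sub_const (lam - e)).const_mul c)).congr_deriv (by simp)
    · exact hasDerivAt_const _ _
    · exact (hf.const_mul c).neg
  -- The constant third factor `1`, with `L = 0`, reduces the triple product rule to a product of
  -- two factors.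
  have hQ : HasDerivAt (fun _ : ℝ => (1 : Mat2)) (1 * 0) s :=
    (hasDerivAt_const s (1 : Mat2)).congr_deriv (by simp)
  have := hasDerivAt_mul_mul_adjugate hF hA hQ (by simp)
  simp only [Matrix.adjugate_one, mul_one, mul_zero, sub_zero] at this
  simp only [Matrix.SpecialLinearGroup.coe_mul]
  refine this.congr_deriv ?_
  refine Eq.trans ?_ (mul_assoc _ _ _).symm
  congr 1
  ext i j; fin_cases i <;> fin_cases j <;> simp [darbouxMatrix] <;> ring

theorem det2_cousin_mul_darbouxMatrix (F : ℝ → SL(2, ℝ)) (f : ℝ → ℝ) {c μ : ℝ}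
    (h : c ^ 2 * μ = 1) (s : ℝ) :
    det2 (cousin F s) (cousin (fun u => F u * darbouxMatrix c μ (f u) h) s) = c := by
  have hF := (F s).det_coe
  rw [Matrix.det_fin_two] at hF
  simp only [det2, cousin, Matrix.SpecialLinearGroup.coe_mul, Matrix.mul_apply, Fin.sum_univ_two]
  simp only [darbouxMatrix, Matrix.of_apply, Matrix.cons_val', Matrix.cons_val_zero,
    Matrix.cons_val_one, Matrix.cons_val_fin_one]
  linear_combination c * hF

theorem hasDerivAt_cousin {F : ℝ → SL(2, ℝ)} {a s : ℝ}
    (hF : HasDerivAt (fun u => (F u : Mat2)) ((F s : Mat2) * !![0, a; 1, 0]) s) :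
    HasDerivAt (cousin F) (fun i => (F s : Mat2) i 1) s := by
  rw [hasDerivAt_matrix_iff] at hF
  rw [hasDerivAt_pi]
  intro i
  exact (hF i 0).congr_deriv (by simp [Matrix.mul_apply, Fin.sum_univ_two])

theorem isStarShaped_cousin {J : Set ℝ} {F : ℝ → SL(2, ℝ)} {a : ℝ → ℝ}
    (hF : ContDiffOn ℝ ∞ (fun u => (F u : Mat2)) J)
    (hF' : ∀ s ∈ J, HasDerivAt (fun u => (F u : Mat2)) ((F s : Mat2) * !![0, a s; 1, 0]) s) :
    IsStarShaped J (cousin F) where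
  smooth := contDiffOn_pi.2 fun i => contDiffOn_matrix_iff.1 hF i 0
  arc_length s hs := by
    have := (F s).det_coe
    rw [Matrix.det_fin_two] at this
    rw [(hasDerivAt_cousin (hF' s hs)).deriv]
    simp only [det2, cousin]
    linear_combination this

/-- The ratio `det(η, η̃') / det(η, η̃) = -f` is independent of `c` and `μ`, hence equal for the two
cousins; this is the reason for `χ = 0`. -/
theorem det2_cousin_deriv_mul_darbouxMatrix {F : ℝ → SL(2, ℝ)} {f : ℝ → ℝ} {c μ a s : ℝ}
    (h : c ^ 2 * μ = 1)
    (hG : HasDerivAt (fun u => ((F u * darbouxMatrix c μ (f u) h : SL(2, ℝ)) : Mat2))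
      (((F s * darbouxMatrix c μ (f s) h : SL(2, ℝ)) : Mat2) * !![0, a; 1, 0]) s) :
    det2 (cousin F s) (deriv (cousin fun u => F u * darbouxMatrix c μ (f u) h) s) =
      -(c * f s) := by
  rw [(hasDerivAt_cousin (F := fun u => F u * darbouxMatrix c μ (f u) h) hG).deriv]
  have hF := (F s).det_coe
  rw [Matrix.det_fin_two] at hF
  simp only [det2, cousin, Matrix.SpecialLinearGroup.coe_mul, Matrix.mul_apply, Fin.sum_univ_two]
  simp only [darbouxMatrix, Matrix.of_apply, Matrix.cons_val', Matrix.cons_val_zero,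
    Matrix.cons_val_one, Matrix.cons_val_fin_one]
  linear_combination -(c * f s) * hF

/-- The coefficients of the Darboux matrices whose quotient is `transformMatrix`, up to sign. -/
theorem exists_darbouxMatrix_quotient (ξ : ℝ) (hξ : ξ ≠ 0) :
    ∃ (cp cm : ℝ) (hp : cp ^ 2 * (Real.cosh (2 * ξ) - 1) = 1)
      (hm : cm ^ 2 * (Real.cosh (2 * ξ) - -1) = 1) (hm' : (-cm) ^ 2 * (Real.cosh (2 * ξ) - -1) = 1),
      ∀ y, transformMatrix ξ hξ y =
          darbouxMatrix cp _ y hp * (darbouxMatrix cm _ y hm)⁻¹ ∧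
        -transformMatrix ξ hξ y =
          darbouxMatrix cp _ y hp * (darbouxMatrix (-cm) _ y hm')⁻¹ := by
  have h1 : Real.sinh ξ ≠ 0 := by simpa using hξ
  have h2 : Real.cosh ξ ≠ 0 := (Real.cosh_pos ξ).ne'
  have h3 := Real.cosh_sq ξ
  have h4 : (√2 : ℝ) ^ 2 = 2 := Real.sq_sqrt (by norm_num)
  have h5 : (√2 : ℝ) ≠ 0 := by positivity
  have hl := Real.cosh_two_mul ξ
  -- Since `cosh 2ξ + 1 = 2 cosh² ξ` and `cosh 2ξ - 1 = 2 sinh² ξ`, the normalization `c² μ = 1`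
  -- determines both coefficients up to sign.
  have hm : (1 / (√2 * Real.cosh ξ)) ^ 2 * (Real.cosh (2 * ξ) - -1) = 1 := by
    rw [hl]; field_simp; rw [h4]; linear_combination -h3
  have hp : (1 / (√2 * Real.sinh ξ)) ^ 2 * (Real.cosh (2 * ξ) - 1) = 1 := by
    rw [hl]; field_simp; rw [h4]; linear_combination h3
  refine ⟨1 / (√2 * Real.sinh ξ), 1 / (√2 * Real.cosh ξ), hp, hm, by rw [neg_sq]; exact hm,
    fun y => ?_⟩
  have key : (!![Real.tanh ξ, -((Real.sinh ξ)⁻¹ * (Real.cosh ξ)⁻¹ * y);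
      0, Real.cosh ξ / Real.sinh ξ] : Mat2) =
      !![-(1 / (√2 * Real.sinh ξ) * y), 1 / (√2 * Real.sinh ξ) * (y ^ 2 - (Real.cosh (2 * ξ) - 1));
        1 / (√2 * Real.sinh ξ), -(1 / (√2 * Real.sinh ξ) * y)] *
      Matrix.adjugate !![-(1 / (√2 * Real.cosh ξ) * y),
        1 / (√2 * Real.cosh ξ) * (y ^ 2 - (Real.cosh (2 * ξ) - -1));
        1 / (√2 * Real.cosh ξ), -(1 / (√2 * Real.cosh ξ) * y)] := by
    rw [hl, Real.tanh_eq_sinh_div_cosh, Matrix.adjugate_fin_two]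
    ext i j
    fin_cases i <;> fin_cases j <;> simp [Matrix.mul_apply, Fin.sum_univ_two] <;> field_simp <;>
      rw [h4] <;> first | ring1 | linear_combination h3 | linear_combination -h3
  constructor
  · apply Subtype.ext
    exact key
  · apply Subtype.ext
    refine (congrArg Neg.neg key).trans ?_
    rw [← Matrix.mul_neg]
    change _ = _ * Matrix.adjugate _
    congr 1
    simp only [Matrix.adjugate_fin_two]
    ext i j
    fin_cases i <;> fin_cases j <;> simp [darbouxMatrix]

section FixedTime

variable {J : Set ℝ} {k f : ℝ → ℝ} {γ γ' Fp Fm : ℝ → SL(2, ℝ)} {cp cm lam : ℝ}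

theorem IsFrenetFrame.darboux (h : IsFrenetFrame J k γ Fp Fm)
    (hf : ∀ s ∈ J, HasDerivAt f (k s + lam - f s ^ 2) s)
    (hp : cp ^ 2 * (lam - 1) = 1) (hm : cm ^ 2 * (lam - -1) = 1)
    (hγ' : ∀ s ∈ J, γ' s = (Fp s * darbouxMatrix cp _ (f s) hp) *
      (Fm s * darbouxMatrix cm _ (f s) hm)⁻¹) :
    IsFrenetFrame J (fun s => -k s + 2 * f s ^ 2 - 2 * lam) γ'
      (fun s => Fp s * darbouxMatrix cp _ (f s) hp)
      (fun s => Fm s * darbouxMatrix cm _ (f s) hm) where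
  lift := hγ'
  pos s hs := hasDerivAt_mul_darbouxMatrix hp (h.pos s hs) (hf s hs)
  neg s hs := hasDerivAt_mul_darbouxMatrix hm (h.neg s hs) (hf s hs)

theorem IsFrenetFrame.isTTransform_darboux (hJ : IsOpen J) (hk : ContDiffOn ℝ ∞ k J)
    (hfs : ContDiffOn ℝ ∞ f J) (h : IsFrenetFrame J k γ Fp Fm)
    (hf : ∀ s ∈ J, HasDerivAt f (k s + lam - f s ^ 2) s)
    (hp : cp ^ 2 * (lam - 1) = 1) (hm : cm ^ 2 * (lam - -1) = 1)
    (hγ' : ∀ s ∈ J, γ' s = (Fp s * darbouxMatrix cp _ (f s) hp) *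
      (Fm s * darbouxMatrix cm _ (f s) hm)⁻¹) :
    IsTTransform J 0 γ γ' := by
  have hG := h.darboux hf hp hm hγ'
  have hk' : ContDiffOn ℝ ∞ (fun s => -k s + 2 * f s ^ 2 - 2 * lam) J :=
    (hk.neg.add (contDiffOn_const.mul (hfs.pow 2))).sub contDiffOn_const
  have hcp : cp ≠ 0 := by rintro rfl; norm_num at hp
  have hcm : cm ≠ 0 := by rintro rfl; norm_num at hm
  refine ⟨h.isNullCurve hJ hk, hG.isNullCurve hJ hk', Fp, Fm, _, _, h.isSpinorFrame hJ,
    hG.isSpinorFrame hJ, ⟨isStarShaped_cousin (h.contDiffOn_pos hJ hk) h.pos,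
    isStarShaped_cousin (hG.contDiffOn_pos hJ hk') hG.pos, cp, hcp, fun s _ => ?_⟩,
    ⟨isStarShaped_cousin (h.contDiffOn_neg hJ hk) h.neg,
    isStarShaped_cousin (hG.contDiffOn_neg hJ hk') hG.neg, cm, hcm, fun s _ => ?_⟩,
    fun s hs => ?_⟩
  · exact det2_cousin_mul_darbouxMatrix _ _ _ _
  · exact det2_cousin_mul_darbouxMatrix _ _ _ _
  · rw [det2_cousin_mul_darbouxMatrix, det2_cousin_mul_darbouxMatrix,
      det2_cousin_deriv_mul_darbouxMatrix hp (hG.pos s hs),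
      det2_cousin_deriv_mul_darbouxMatrix hm (hG.neg s hs)]
    ring

end FixedTime


/-! ### Jets of a null curve and of its transform -/

section IteratedDeriv

variable {E : Type*} [NormedAddCommGroup E] [NormedSpace ℝ E]

theorem hasDerivAt_iteratedDeriv {J : Set ℝ} (hJ : IsOpen J) {g : ℝ → E}
    (hg : ContDiffOn ℝ ∞ g J) (n : ℕ) {s : ℝ} (hs : s ∈ J) :
    HasDerivAt (iteratedDeriv n g) (iteratedDeriv (n + 1) g s) s := by
  have h : ContDiffOn ℝ ∞ (iteratedDeriv n g) J := by
    clear hs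
    induction n with
    | zero => rwa [iteratedDeriv_zero]
    | succ n ih =>
      rw [iteratedDeriv_succ]
      exact ((contDiffOn_infty_iff_deriv_of_isOpen hJ).1 ih).2
  rw [iteratedDeriv_succ]
  exact (differentiableAt_of_contDiffOn hJ h hs).hasDerivAt

theorem iteratedDeriv_succ_eq_of_eqOn {J : Set ℝ} (hJ : IsOpen J) {g h : ℝ → E} {h' : E} {n : ℕ}
    (hgh : ∀ u ∈ J, iteratedDeriv n g u = h u) {s : ℝ} (hs : s ∈ J) (hh : HasDerivAt h h' s) :
    iteratedDeriv (n + 1) g s = h' := by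
  rw [iteratedDeriv_succ]
  refine (hh.congr_of_eventuallyEq ?_).deriv
  filter_upwards [hJ.mem_nhds hs] with u hu using hgh u hu

theorem iteratedDeriv_congr_of_isOpen {J : Set ℝ} (hJ : IsOpen J) {g h : ℝ → E}
    (hgh : ∀ u ∈ J, g u = h u) (n : ℕ) {s : ℝ} (hs : s ∈ J) :
    iteratedDeriv n g s = iteratedDeriv n h s := by
  refine Filter.EventuallyEq.iteratedDeriv_eq n ?_
  filter_upwards [hJ.mem_nhds hs] with u hu using hgh u hu

end IteratedDeriv

theorem hasDerivAt_adsInner {P Q : ℝ → Mat2} {P' Q' : Mat2} {s : ℝ} (hP : HasDerivAt P P' s)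
    (hQ : HasDerivAt Q Q' s) :
    HasDerivAt (fun u => adsInner (P u) (Q u)) (adsInner P' (Q s) + adsInner (P s) Q') s := by
  rw [hasDerivAt_matrix_iff] at hP hQ
  refine ((((((hP 0 1).mul (hQ 1 0)).add ((hP 1 0).mul (hQ 0 1))).sub
    ((hP 0 0).mul (hQ 1 1))).sub ((hP 1 1).mul (hQ 0 0))).div_const 2).congr_deriv ?_
  simp only [adsInner]; ring

/-- The linear combination of a curve and its first three derivatives with given coefficients. -/
noncomputable def jetCombination (γ : ℝ → SL(2, ℝ)) (a b c d s : ℝ) : Mat2 :=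
  a • curveDeriv 0 γ s + b • curveDeriv 1 γ s + c • curveDeriv 2 γ s + d • curveDeriv 3 γ s

section FixedTime

variable {J : Set ℝ} {k f : ℝ → ℝ} {γ Fp Fm : ℝ → SL(2, ℝ)}

/-- The fourth-order equation for `γ` makes combinations of `γ, γ', γ'', γ'''` closed under
differentiation; the terms in `d s` come from it. -/
theorem IsFrenetFrame.hasDerivAt_jetCombination (hJ : IsOpen J) (h : IsFrenetFrame J k γ Fp Fm)
    {s k' : ℝ} (hs : s ∈ J) (hk : HasDerivAt k k' s) {a b c d : ℝ → ℝ} {a' b' c' d' : ℝ}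
    (ha : HasDerivAt a a' s) (hb : HasDerivAt b b' s) (hc : HasDerivAt c c' s)
    (hd : HasDerivAt d d' s) :
    HasDerivAt (fun u => jetCombination γ (a u) (b u) (c u) (d u) u)
      (jetCombination γ (a' - 4 * d s) (b' + a s + 2 * k' * d s) (c' + b s + 4 * k s * d s)
        (d' + c s) s) s := by
  have h0 : HasDerivAt (curveDeriv 0 γ) (curveDeriv 1 γ s) s := by
    rw [curveDeriv_succ]
    exact (h.hasDerivAt_curveDeriv hJ hs (fun u hu => h.curveDeriv_zero hu)
      (hasDerivAt_const s 1)).differentiableAt.hasDerivAt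
  have h1 : HasDerivAt (curveDeriv 1 γ) (curveDeriv 2 γ s) s := by
    rw [curveDeriv_succ 1]
    exact (h.hasDerivAt_curveDeriv hJ hs (fun u hu => h.curveDeriv_one hJ hu)
      (hasDerivAt_const s _)).differentiableAt.hasDerivAt
  have h2 : HasDerivAt (curveDeriv 2 γ) (curveDeriv 3 γ s) s := by
    rw [curveDeriv_succ 2]
    exact (h.hasDerivAt_curveDeriv hJ hs (fun u hu => h.curveDeriv_two hJ hu)
      (hasDerivAt_const s _)).differentiableAt.hasDerivAt
  have h3 := h.hasDerivAt_curveDeriv_three hJ hs hk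
  refine ((((ha.smul h0).add (hb.smul h1)).add (hc.smul h2)).add (hd.smul h3)).congr_deriv ?_
  simp only [jetCombination]
  module

/-- These are the velocities of `γ', γ'', γ'''` under the flow. The first two enter the evolution of
the transform, the third that of the bending. -/
theorem IsFrenetFrame.iteratedDeriv_lienVelocity (hJ : IsOpen J) (hk : ContDiffOn ℝ ∞ k J)
    (h : IsFrenetFrame J k γ Fp Fm) {s : ℝ} (hs : s ∈ J) :
    (iteratedDeriv 1 (fun u => jetCombination γ 0 (-6 * k u) 0 2 u) s =
      jetCombination γ (-8) (-2 * iteratedDeriv 1 k s) (2 * k s) 0 s) ∧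
    (iteratedDeriv 2 (fun u => jetCombination γ 0 (-6 * k u) 0 2 u) s =
      jetCombination γ 0 (-8 - 2 * iteratedDeriv 2 k s) 0 (2 * k s) s) ∧
    (iteratedDeriv 3 (fun u => jetCombination γ 0 (-6 * k u) 0 2 u) s =
      jetCombination γ (-8 * k s) (4 * k s * iteratedDeriv 1 k s - 2 * iteratedDeriv 3 k s)
        (8 * k s ^ 2 - 8 - 2 * iteratedDeriv 2 k s) (2 * iteratedDeriv 1 k s) s) := by
  have d0 : ∀ u ∈ J, HasDerivAt k (iteratedDeriv 1 k u) u := fun u hu => by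
    simpa using hasDerivAt_iteratedDeriv hJ hk 0 hu
  have d1 : ∀ u ∈ J, HasDerivAt (iteratedDeriv 1 k) (iteratedDeriv 2 k u) u := fun u hu =>
    hasDerivAt_iteratedDeriv hJ hk 1 hu
  have d2 : ∀ u ∈ J, HasDerivAt (iteratedDeriv 2 k) (iteratedDeriv 3 k u) u := fun u hu =>
    hasDerivAt_iteratedDeriv hJ hk 2 hu
  have c (x : ℝ) (u : ℝ) : HasDerivAt (fun _ : ℝ => x) 0 u := hasDerivAt_const u x
  have e1 : ∀ u ∈ J, iteratedDeriv 1 (fun u => jetCombination γ 0 (-6 * k u) 0 2 u) u =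
      jetCombination γ (-8) (-2 * iteratedDeriv 1 k u) (2 * k u) 0 u := fun u hu => by
    refine (iteratedDeriv_succ_eq_of_eqOn hJ (fun v _ => by rw [iteratedDeriv_zero]) hu
      (h.hasDerivAt_jetCombination hJ hu (d0 u hu) (c 0 u) ((d0 u hu).const_mul (-6)) (c 0 u)
        (c 2 u))).trans ?_
    congr 1 <;> ring
  have e2 : ∀ u ∈ J, iteratedDeriv 2 (fun u => jetCombination γ 0 (-6 * k u) 0 2 u) u =
      jetCombination γ 0 (-8 - 2 * iteratedDeriv 2 k u) 0 (2 * k u) u := fun u hu => by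
    refine (iteratedDeriv_succ_eq_of_eqOn hJ e1 hu
      (h.hasDerivAt_jetCombination hJ hu (d0 u hu) (c (-8) u) ((d1 u hu).const_mul (-2))
        ((d0 u hu).const_mul 2) (c 0 u))).trans ?_
    congr 1 <;> ring
  refine ⟨e1 s hs, e2 s hs, ?_⟩
  refine (iteratedDeriv_succ_eq_of_eqOn hJ e2 hs
    (h.hasDerivAt_jetCombination hJ hs (d0 s hs) (c 0 s) (((d2 s hs).const_mul 2).const_sub (-8))
      (c 0 s) ((d0 s hs).const_mul 2))).trans ?_
  congr 1 <;> ring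

/-- The curve `λγ - fγ' + γ''/2` is the transform up to a constant factor. Derivatives of `f` are
eliminated by the Riccati equation, leaving only the first and third derivatives needed for the
right side of the flow. -/
theorem IsFrenetFrame.iteratedDeriv_transform (hJ : IsOpen J) (hk : ContDiffOn ℝ ∞ k J)
    (h : IsFrenetFrame J k γ Fp Fm) {lam : ℝ}
    (hf : ∀ s ∈ J, HasDerivAt f (k s + lam - f s ^ 2) s) {s : ℝ} (hs : s ∈ J) :
    (iteratedDeriv 1 (fun u => jetCombination γ lam (-f u) (1 / 2) 0 u) s =
      jetCombination γ 0 (f s ^ 2 - k s) (-f s) (1 / 2) s) ∧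
    (iteratedDeriv 3 (fun u => jetCombination γ lam (-f u) (1 / 2) 0 u) s =
      jetCombination γ (4 * f s)
        (2 * (k s + lam - f s ^ 2) ^ 2 +
          2 * f s * (iteratedDeriv 1 k s - 2 * f s * (k s + lam - f s ^ 2)) - 2 -
          2 * iteratedDeriv 1 k s * f s)
        (6 * f s * (k s + lam - f s ^ 2) - 4 * k s * f s)
        (3 * f s ^ 2 - k s - 2 * lam) s) := by
  have d0 : ∀ u ∈ J, HasDerivAt k (iteratedDeriv 1 k u) u := fun u hu => by
    simpa using hasDerivAt_iteratedDeriv hJ hk 0 hu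
  have c (x : ℝ) (u : ℝ) : HasDerivAt (fun _ : ℝ => x) 0 u := hasDerivAt_const u x
  have e1 : ∀ u ∈ J, iteratedDeriv 1 (fun u => jetCombination γ lam (-f u) (1 / 2) 0 u) u =
      jetCombination γ 0 (f u ^ 2 - k u) (-f u) (1 / 2) u := fun u hu => by
    refine (iteratedDeriv_succ_eq_of_eqOn hJ (fun v _ => by rw [iteratedDeriv_zero]) hu
      (h.hasDerivAt_jetCombination hJ hu (d0 u hu) (c lam u) (hf u hu).fun_neg (c (1 / 2) u)
        (c 0 u))).trans ?_
    congr 1 <;> ring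
  have e2 : ∀ u ∈ J, iteratedDeriv 2 (fun u => jetCombination γ lam (-f u) (1 / 2) 0 u) u =
      jetCombination γ (-2) (2 * (f u * (k u + lam - f u ^ 2))) (2 * f u ^ 2 - lam) (-f u) u :=
    fun u hu => by
    refine (iteratedDeriv_succ_eq_of_eqOn hJ e1 hu
      (h.hasDerivAt_jetCombination hJ hu (d0 u hu) (c 0 u) (((hf u hu).pow 2).sub (d0 u hu))
        (hf u hu).fun_neg (c (1 / 2) u))).trans ?_
    congr 1 <;> norm_num <;> ring
  refine ⟨e1 s hs, ?_⟩
  refine (iteratedDeriv_succ_eq_of_eqOn hJ e2 hs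
    (h.hasDerivAt_jetCombination hJ hs (d0 s hs) (c (-2) s)
      (((hf s hs).mul (((d0 s hs).add_const lam).sub ((hf s hs).pow 2))).const_mul 2)
      ((((hf s hs).pow 2).const_mul 2).sub_const lam) (hf s hs).fun_neg)).trans ?_
  congr 1 <;> norm_num <;> ring

/-- The lower left entry of `transformMatrix` is zero, so it is a combination of the matrices of `γ,
γ', γ''` alone. The diagonal entries are `(cosh 2ξ ∓ 1) / (2 sinh ξ cosh ξ)`. -/
theorem IsFrenetFrame.transformMatrix_conj (hJ : IsOpen J) (h : IsFrenetFrame J k γ Fp Fm)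
    (ξ : ℝ) (hξ : ξ ≠ 0) (y : ℝ) {s : ℝ} (hs : s ∈ J) :
    ((Fp s * transformMatrix ξ hξ y * (Fm s)⁻¹ : SL(2, ℝ)) : Mat2) =
      (1 / (2 * Real.sinh ξ * Real.cosh ξ)) •
        jetCombination γ (Real.cosh (2 * ξ)) (-y) (1 / 2) 0 s := by
  have h1 : Real.sinh ξ ≠ 0 := by simpa using hξ
  have h2 : Real.cosh ξ ≠ 0 := (Real.cosh_pos ξ).ne'
  have h3 := Real.cosh_sq ξ
  have hM : (transformMatrix ξ hξ y : Mat2) = (1 / (2 * Real.sinh ξ * Real.cosh ξ)) •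
      (Real.cosh (2 * ξ) • (1 : Mat2) + (-y) • !![0, 2; 0, 0] + (1 / 2 : ℝ) • !![-2, 0; 0, 2]) := by
    change !![Real.tanh ξ, -((Real.sinh ξ)⁻¹ * (Real.cosh ξ)⁻¹ * y);
      0, Real.cosh ξ / Real.sinh ξ] = _
    rw [Real.cosh_two_mul, Real.tanh_eq_sinh_div_cosh]
    ext i j
    fin_cases i <;> fin_cases j <;> simp <;> field_simp <;>
      first | linear_combination h3 | linear_combination -h3
  rw [jetCombination, zero_smul, add_zero, h.curveDeriv_zero hs, h.curveDeriv_one hJ hs,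
    h.curveDeriv_two hJ hs, linearCombination_conj, Matrix.SpecialLinearGroup.coe_mul,
    Matrix.SpecialLinearGroup.coe_mul, Matrix.SpecialLinearGroup.coe_inv, hM, Matrix.mul_smul,
    Matrix.smul_mul]

end FixedTime

/-! ### Evolution under the LIEN flow -/

section Flow

variable {J I : Set ℝ} {γ Fp Fm : ℝ → ℝ → SL(2, ℝ)}

theorem IsLIENSolution.curveDeriv_eq (hJ : IsOpen J) (hI : IsOpen I) (h : IsLIENSolution J I γ)
    (n : ℕ) {s t : ℝ} (hs : s ∈ J) (ht : t ∈ I) :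
    curveDeriv n (fun u => γ u t) s =
      partialS^[n] (fun p : ℝ × ℝ => (γ p.1 p.2 : Mat2)) (s, t) :=
  iteratedDeriv_eq_iterate_partialS hJ hI h.smooth n hs ht

theorem IsLIENSolution.contDiffOn_curveDeriv (hJ : IsOpen J) (hI : IsOpen I)
    (h : IsLIENSolution J I γ) (n : ℕ) :
    ContDiffOn ℝ ∞ (fun p : ℝ × ℝ => curveDeriv n (fun u => γ u p.2) p.1) (J ×ˢ I) :=
  (contDiffOn_iterate_partialS (hJ.prod hI) h.smooth n).congr fun _ hp =>
    h.curveDeriv_eq hJ hI n hp.1 hp.2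

theorem IsLIENSolution.contDiffOn_familyBending (hJ : IsOpen J) (hI : IsOpen I)
    (h : IsLIENSolution J I γ) :
    ContDiffOn ℝ ∞ (fun p : ℝ × ℝ => familyBending γ p.1 p.2) (J ×ˢ I) :=
  contDiffOn_const.mul (contDiffOn_adsInner (h.contDiffOn_curveDeriv hJ hI 3)
    (h.contDiffOn_curveDeriv hJ hI 3))

theorem contDiffOn_slice {E : Type*} [NormedAddCommGroup E] [NormedSpace ℝ E] {g : ℝ → ℝ → E}
    (hg : ContDiffOn ℝ ∞ (fun p : ℝ × ℝ => g p.1 p.2) (J ×ˢ I)) {t : ℝ} (ht : t ∈ I) :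
    ContDiffOn ℝ ∞ (fun s => g s t) J :=
  hg.comp (contDiff_id.prodMk contDiff_const).contDiffOn fun _ hs => ⟨hs, ht⟩

theorem IsLIENSolution.hasDerivAt_curveDeriv (hJ : IsOpen J) (hI : IsOpen I)
    (h : IsLIENSolution J I γ) (n : ℕ) {s t : ℝ} (hs : s ∈ J) (ht : t ∈ I) :
    HasDerivAt (fun τ => curveDeriv n (fun u => γ u τ) s)
      (iteratedDeriv n (fun u =>
        jetCombination (fun v => γ v t) 0 (-6 * familyBending γ u t) 0 2 u) s) t := by
  have hU := hJ.prod hI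
  have hd := (differentiableAt_of_contDiffOn hU (contDiffOn_iterate_partialS hU h.smooth n)
    (p := (s, t)) ⟨hs, ht⟩).hasDerivAt_partialT
  rw [partialT_iterate_partialS hU h.smooth n ⟨hs, ht⟩,
    ← iteratedDeriv_eq_iterate_partialS hJ hI (contDiffOn_partialT hU h.smooth) n hs ht] at hd
  have hV : ∀ u ∈ J, partialT (fun p : ℝ × ℝ => (γ p.1 p.2 : Mat2)) (u, t) =
      jetCombination (fun v => γ v t) 0 (-6 * familyBending γ u t) 0 2 u := fun u hu => by
    have := (differentiableAt_of_contDiffOn hU h.smooth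
      (p := (u, t)) ⟨hu, ht⟩).hasDerivAt_partialT.deriv
    rw [← this]
    refine (h.flow u hu t ht).trans ?_
    simp only [jetCombination]
    module
  rw [iteratedDeriv_congr_of_isOpen hJ hV n hs] at hd
  refine hd.congr_of_eventuallyEq ?_
  filter_upwards [hI.mem_nhds ht] with τ hτ using h.curveDeriv_eq hJ hI n hs hτ

/-- Here `∂ₜκ = -(1/8) ⟨∂ₜγ''', γ'''⟩`. If `b, d` are the coefficients of `γ', γ'''` in `∂ₜγ'''`,
this is `b/2 + 2κd = 6κκ' - κ'''`. -/
theorem IsLIENSolution.isKdVSolution (hJ : IsOpen J) (hI : IsOpen I) (h : IsLIENSolution J I γ)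
    (hF : ∀ t ∈ I, IsSpinorFrame J (fun s => γ s t) (fun s => Fp s t) (fun s => Fm s t)) :
    IsKdVSolution J I (familyBending γ) where
  smooth := h.contDiffOn_familyBending hJ hI
  kdv s hs t ht := by
    have hfr := (hF t ht).isFrenetFrame
    have hk : ContDiffOn ℝ ∞ (bending fun u => γ u t) J :=
      contDiffOn_slice (h.contDiffOn_familyBending hJ hI) ht
    have h3 := h.hasDerivAt_curveDeriv hJ hI 3 hs ht
    have hV : iteratedDeriv 3 (fun u =>
        jetCombination (fun v => γ v t) 0 (-6 * familyBending γ u t) 0 2 u) s = _ :=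
      (hfr.iteratedDeriv_lienVelocity hJ hk hs).2.2
    rw [hV] at h3
    have hκ : HasDerivAt (fun τ => familyBending γ s τ) _ t :=
      (hasDerivAt_adsInner h3 h3).const_mul (-(1 / 16))
    rw [hκ.deriv, adsInner_comm (curveDeriv 3 (fun u => γ u t) s)]
    have e : ∀ a b c d : ℝ, adsInner (jetCombination (fun v => γ v t) a b c d s)
        (curveDeriv 3 (fun u => γ u t) s) = -4 * b - 16 * bending (fun u => γ u t) s * d := by
      intro a b c d
      have : jetCombination (fun v => γ v t) a b c d s =
        (1 : ℝ) • (a • curveDeriv 0 (fun v => γ v t) s + b • curveDeriv 1 (fun v => γ v t) s) +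
        (1 : ℝ) • (c • curveDeriv 2 (fun v => γ v t) s + d • curveDeriv 3 (fun v => γ v t) s) := by
        simp only [jetCombination]; module
      rw [this, adsInner_smul_add_smul_left, adsInner_smul_add_smul_left,
        adsInner_smul_add_smul_left, hfr.adsInner_curveDeriv_zero_three hJ hs,
        hfr.adsInner_curveDeriv_one_three hJ hs, hfr.adsInner_curveDeriv_two_three hJ hs,
        hfr.adsInner_curveDeriv_three_three hJ hs]
      ring
    rw [e, show (fun u => familyBending γ u t) = bending fun u => γ u t from rfl,
      show familyBending γ s t = bending (fun u => γ u t) s from rfl, iteratedDeriv_one]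
    ring

/-- The equation expresses `df` polynomially in `f` with coefficients built from `κ, ∂ₛκ, ∂ₛ²κ`,
which are smooth, so the bootstrap applies. -/
theorem IsWahlquistEstabrookSolution.contDiffOn (hJ : IsOpen J) (hI : IsOpen I)
    {κ f : ℝ → ℝ → ℝ} {lam : ℝ}
    (hκ : ContDiffOn ℝ ∞ (fun p : ℝ × ℝ => κ p.1 p.2) (J ×ˢ I))
    (hf : IsWahlquistEstabrookSolution J I κ lam f) :
    ContDiffOn ℝ ∞ (fun p : ℝ × ℝ => f p.1 p.2) (J ×ˢ I) := by
  have hU := hJ.prod hI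
  have h1 : ContDiffOn ℝ ∞ (fun p : ℝ × ℝ => deriv (fun u => κ u p.2) p.1) (J ×ˢ I) :=
    (contDiffOn_iterate_partialS hU hκ 1).congr fun p hp => by
      rw [← iteratedDeriv_one]
      exact iteratedDeriv_eq_iterate_partialS hJ hI hκ 1 hp.1 hp.2
  have h2 : ContDiffOn ℝ ∞ (fun p : ℝ × ℝ => iteratedDeriv 2 (fun u => κ u p.2) p.1) (J ×ˢ I) :=
    (contDiffOn_iterate_partialS hU hκ 2).congr fun p hp =>
      iteratedDeriv_eq_iterate_partialS hJ hI hκ 2 hp.1 hp.2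
  refine contDiffOn_infty_of_hasFDerivAt_of_bootstrap hU (fun p hp => hf p.1 hp.1 p.2 hp.2)
    fun n hn => ?_
  have hκ' := hκ.of_le (m := n) (mod_cast le_top)
  have h1' := h1.of_le (m := n) (mod_cast le_top)
  have h2' := h2.of_le (m := n) (mod_cast le_top)
  fun_prop

theorem IsWahlquistEstabrookSolution.hasDerivAt_left {κ f : ℝ → ℝ → ℝ} {lam : ℝ}
    (hf : IsWahlquistEstabrookSolution J I κ lam f) {s t : ℝ} (hs : s ∈ J) (ht : t ∈ I) :
    HasDerivAt (fun u => f u t) (κ s t + lam - f s t ^ 2) s :=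
  (HasFDerivAt.comp_hasDerivAt (f := fun u => (u, t)) s (hf s hs t ht) ((hasDerivAt_id s).prodMk (hasDerivAt_const s t))).congr_deriv
    (by simp; ring)

theorem IsWahlquistEstabrookSolution.hasDerivAt_right {κ f : ℝ → ℝ → ℝ} {lam : ℝ}
    (hf : IsWahlquistEstabrookSolution J I κ lam f) {s t : ℝ} (hs : s ∈ J) (ht : t ∈ I) :
    HasDerivAt (fun τ => f s τ) (4 * lam * (f s t ^ 2 - lam) - 2 * κ s t * (f s t ^ 2 + lam) +
      2 * κ s t ^ 2 + 2 * f s t * iteratedDeriv 1 (fun u => κ u t) s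
      - iteratedDeriv 2 (fun u => κ u t) s) t :=
  (HasFDerivAt.comp_hasDerivAt (f := fun τ => (s, τ)) t (hf s hs t ht) ((hasDerivAt_const t s).prodMk (hasDerivAt_id t))).congr_deriv
    (by simp)

/-- Both sides of the flow equation are jet combinations of `γ`, and their coefficients agree. The
`∂ₛ²κ` from `∂ₜf` cancels the one from `∂ₜγ''`; the KdV equation is not needed. -/
theorem IsLIENSolution.of_jetCombination (hJ : IsOpen J) (hI : IsOpen I)
    (h : IsLIENSolution J I γ)
    (hF : ∀ t ∈ I, IsSpinorFrame J (fun s => γ s t) (fun s => Fp s t) (fun s => Fm s t))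
    {f : ℝ → ℝ → ℝ} {lam m : ℝ} (hf : IsWahlquistEstabrookSolution J I (familyBending γ) lam f)
    {γ' : ℝ → ℝ → SL(2, ℝ)}
    (hγ' : ∀ s ∈ J, ∀ t ∈ I, (γ' s t : Mat2) =
      m • jetCombination (fun u => γ u t) lam (-f s t) (1 / 2) 0 s)
    (hnull : ∀ t ∈ I, IsNullCurve J fun s => γ' s t)
    (hbend : ∀ s ∈ J, ∀ t ∈ I,
      familyBending γ' s t = -familyBending γ s t + 2 * f s t ^ 2 - 2 * lam) :
    IsLIENSolution J I γ' where
  smooth := by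
    have hfs := hf.contDiffOn hJ hI (h.contDiffOn_familyBending hJ hI)
    have h0 := h.contDiffOn_curveDeriv hJ hI 0
    have h1 := h.contDiffOn_curveDeriv hJ hI 1
    have h2 := h.contDiffOn_curveDeriv hJ hI 2
    refine ContDiffOn.congr (f := fun p : ℝ × ℝ => m • (lam • curveDeriv 0 (fun u => γ u p.2) p.1 +
      (-f p.1 p.2) • curveDeriv 1 (fun u => γ u p.2) p.1 +
      (1 / 2 : ℝ) • curveDeriv 2 (fun u => γ u p.2) p.1)) ?_ fun p hp => ?_
    · exact (((h0.const_smul lam).add (hfs.neg.smul h1)).add (h2.const_smul _)).const_smul m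
    · rw [hγ' p.1 hp.1 p.2 hp.2, jetCombination, zero_smul, add_zero]
  nullCurve := hnull
  flow s hs t ht := by
    have hfr := (hF t ht).isFrenetFrame
    have hk : ContDiffOn ℝ ∞ (bending fun u => γ u t) J :=
      contDiffOn_slice (h.contDiffOn_familyBending hJ hI) ht
    have hfl : ∀ u ∈ J, HasDerivAt (fun v => f v t)
        (bending (fun v => γ v t) u + lam - f u t ^ 2) u := fun u hu => hf.hasDerivAt_left hu ht
    have e : ∀ n, curveDeriv n (fun u => γ' u t) s = m • iteratedDeriv n
        (fun u => jetCombination (fun u => γ u t) lam (-f u t) (1 / 2) 0 u) s := fun n => by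
      rw [curveDeriv, iteratedDeriv_congr_of_isOpen hJ (fun u hu => hγ' u hu t ht) n hs]
      exact iteratedDeriv_fun_const_smul_field m _
    obtain ⟨w1, w3⟩ := hfr.iteratedDeriv_transform hJ hk hfl hs
    obtain ⟨v1, v2, -⟩ := hfr.iteratedDeriv_lienVelocity hJ hk hs
    have t0 := h.hasDerivAt_curveDeriv hJ hI 0 hs ht
    have t1 := (h.hasDerivAt_curveDeriv hJ hI 1 hs ht).congr_deriv v1
    have t2 := (h.hasDerivAt_curveDeriv hJ hI 2 hs ht).congr_deriv v2
    rw [iteratedDeriv_zero] at t0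
    have hd := ((((t0.const_smul lam).add ((hf.hasDerivAt_right hs ht).fun_neg.smul t1)).add
      (t2.const_smul (1 / 2 : ℝ))).const_smul m).congr_of_eventuallyEq
      (f₁ := fun τ => (γ' s τ : Mat2)) (by
        filter_upwards [hI.mem_nhds ht] with τ hτ
        rw [hγ' s hs τ hτ, jetCombination, zero_smul, add_zero]; rfl)
    refine hd.deriv.trans ?_
    rw [e, e, w1, w3, hbend s hs t ht]
    simp only [jetCombination, familyBending]
    -- For example, the coefficients of `γ'''` match because `2λ + κ = 2(3f² - κ - 2λ) - 3κ̃`.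
    module

end Flow


/-! ### Assembling the theorem -/

/-- The conclusions of the main theorem, when the transform is given by Darboux matrices. -/
theorem transform_conclusions {J I : Set ℝ} (hJ : IsOpen J) (hI : IsOpen I)
    {γ Fp Fm : ℝ → ℝ → SL(2, ℝ)} (hγ : IsLIENSolution J I γ)
    (hF : ∀ t ∈ I, IsSpinorFrame J (fun s => γ s t) (fun s => Fp s t) (fun s => Fm s t))
    {ξ : ℝ} (hξ : ξ ≠ 0) {f : ℝ → ℝ → ℝ}
    (hf : IsWahlquistEstabrookSolution J I (familyBending γ) (Real.cosh (2 * ξ)) f)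
    {γ' : ℝ → ℝ → SL(2, ℝ)}
    (hγ' : (∀ s ∈ J, ∀ t ∈ I, γ' s t = Fp s t * transformMatrix ξ hξ (f s t) * (Fm s t)⁻¹) ∨
      (∀ s ∈ J, ∀ t ∈ I, γ' s t = -(Fp s t * transformMatrix ξ hξ (f s t) * (Fm s t)⁻¹)))
    {cp cm m : ℝ} (hp : cp ^ 2 * (Real.cosh (2 * ξ) - 1) = 1)
    (hm : cm ^ 2 * (Real.cosh (2 * ξ) - -1) = 1)
    (hD : ∀ s ∈ J, ∀ t ∈ I, γ' s t = (Fp s t * darbouxMatrix cp _ (f s t) hp) *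
      (Fm s t * darbouxMatrix cm _ (f s t) hm)⁻¹)
    (hjet : ∀ s ∈ J, ∀ t ∈ I, (γ' s t : Mat2) =
      m • jetCombination (fun u => γ u t) (Real.cosh (2 * ξ)) (-f s t) (1 / 2) 0 s) :
    (∀ t ∈ I, IsTTransform J 0 (fun s => γ s t) (fun s => γ' s t) ∧
      IsTTransformWith J ξ hξ (fun s => f s t) (fun s => γ s t) (fun s => γ' s t)) ∧
    IsLIENSolution J I γ' ∧
    IsBacklundTransform J I (familyBending γ) (Real.cosh (2 * ξ)) f (familyBending γ') := by
  have hκ := hγ.contDiffOn_familyBending hJ hI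
  have hfs := hf.contDiffOn hJ hI hκ
  have hfl : ∀ t ∈ I, ∀ s ∈ J, HasDerivAt (fun u => f u t)
      (bending (fun u => γ u t) s + Real.cosh (2 * ξ) - f s t ^ 2) s :=
    fun t ht s hs => hf.hasDerivAt_left hs ht
  have hT : ∀ t ∈ I, IsTTransform J 0 (fun s => γ s t) (fun s => γ' s t) := fun t ht =>
    (hF t ht).isFrenetFrame.isTTransform_darboux hJ (contDiffOn_slice hκ ht)
      (contDiffOn_slice hfs ht) (hfl t ht) hp hm fun s hs => hD s hs t ht
  have hbend : ∀ s ∈ J, ∀ t ∈ I,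
      familyBending γ' s t = -familyBending γ s t + 2 * f s t ^ 2 - 2 * Real.cosh (2 * ξ) :=
    fun s hs t ht => ((hF t ht).isFrenetFrame.darboux (hfl t ht) hp hm
      fun s hs => hD s hs t ht).bending_eq hJ hs
  refine ⟨fun t ht => ⟨hT t ht, (hT t ht).1, (hT t ht).2.1, hfl t ht, _, _, hF t ht, ?_⟩,
    hγ.of_jetCombination hJ hI hF hf hjet (fun t ht => (hT t ht).2.1) hbend,
    hγ.isKdVSolution hJ hI hF, (Real.cosh_pos _).ne', hbend⟩
  exact hγ'.imp (fun h s hs => h s hs t ht) fun h s hs => h s hs t ht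

end NullCurveKdV

open NullCurveKdV in
theorem theorem4p3 (J I : Set ℝ) (hJ : IsOpen J) (hJ' : J.OrdConnected)
    (hI : IsOpen I) (hI' : I.OrdConnected)
    (γ Fp Fm : ℝ → ℝ → SL(2, ℝ))
    (hγ : NullCurveKdV.IsLIENSolution J I γ)
    (hF : ∀ t ∈ I, NullCurveKdV.IsSpinorFrame J
      (fun s => γ s t) (fun s => Fp s t) (fun s => Fm s t))
    (ξ : ℝ) (hξ : ξ ≠ 0) (f : ℝ → ℝ → ℝ)
    (hf : NullCurveKdV.IsWahlquistEstabrookSolution J I (NullCurveKdV.familyBending γ)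
      (Real.cosh (2 * ξ)) f)
    (γ' : ℝ → ℝ → SL(2, ℝ))
    (hγ' :
      (∀ s ∈ J, ∀ t ∈ I, γ' s t =
        Fp s t * NullCurveKdV.transformMatrix ξ hξ (f s t) * (Fm s t)⁻¹) ∨
      (∀ s ∈ J, ∀ t ∈ I, γ' s t =
        -(Fp s t * NullCurveKdV.transformMatrix ξ hξ (f s t) * (Fm s t)⁻¹))) :
    (∀ t ∈ I,
      NullCurveKdV.IsTTransform J 0 (fun s => γ s t) (fun s => γ' s t) ∧
      NullCurveKdV.IsTTransformWith J ξ hξ (fun s => f s t)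
        (fun s => γ s t) (fun s => γ' s t)) ∧
    NullCurveKdV.IsLIENSolution J I γ' ∧
    NullCurveKdV.IsBacklundTransform J I (NullCurveKdV.familyBending γ)
      (Real.cosh (2 * ξ)) f (NullCurveKdV.familyBending γ') := by
  obtain ⟨cp, cm, hp, hm, hm', hD⟩ := exists_darbouxMatrix_quotient ξ hξ
  have hM : ∀ s ∈ J, ∀ t ∈ I,
      ((Fp s t * transformMatrix ξ hξ (f s t) * (Fm s t)⁻¹ : SL(2, ℝ)) : Mat2) =
        (1 / (2 * Real.sinh ξ * Real.cosh ξ)) •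
          jetCombination (fun u => γ u t) (Real.cosh (2 * ξ)) (-f s t) (1 / 2) 0 s :=
    fun s hs t ht => (hF t ht).isFrenetFrame.transformMatrix_conj hJ ξ hξ (f s t) hs
  rcases hγ' with h | h
  · refine transform_conclusions hJ hI hγ hF hξ hf (Or.inl h) hp hm
      (m := 1 / (2 * Real.sinh ξ * Real.cosh ξ)) (fun s hs t ht => ?_) fun s hs t ht => ?_
    · rw [h s hs t ht, (hD (f s t)).1]
      group
    · rw [h s hs t ht]
      exact hM s hs t ht
  -- The minus sign is absorbed by replacing `cm` with `-cm`, which leaves `cm² μ = 1` intact, and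
  -- by negating the scalar `m`.
  · refine transform_conclusions hJ hI hγ hF hξ hf (Or.inr h) hp hm'
      (m := -(1 / (2 * Real.sinh ξ * Real.cosh ξ))) (fun s hs t ht => ?_) fun s hs t ht => ?_
    · rw [h s hs t ht, ← neg_mul, ← mul_neg, (hD (f s t)).2]
      group
    · rw [h s hs t ht, neg_smul, ← hM s hs t ht]
      exact Matrix.SpecialLinearGroup.coe_neg _
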